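/- \textbf{Lemma (parametric regression).} Let $C>0$ and let $\epsilon_1,\dots,\epsilon_n$ be i.i.d. Rademacher random variables. \textbf{(1) Arbitrary noise.} Let $X_1,\dots,X_n\in\mathbb{R}^p$ and $\xi_1,\dots,\xi_n\in\mathbb{R}$ be fixed (in the regression $Y_i=X_i^{\mathsf T}\beta^*+\xi_i$, the $\xi_i$ need not be centered), put $G=\sum_{i=1}^n X_iX_i^{\mathsf T}$ and $H=\sum_{i=1}^n\xi_i^2X_iX_i^{\mathsf T}$, and assume that $G$ is invertible. Let $$S=\sup_{\beta\in\mathbb{R}^p}\frac1n\sum_{i=1}^n\left(2\epsilon_i\xi_iX_i^{\mathsf T}\beta-C\,\beta^{\mathsf T}X_iX_i^{\mathsf T}\beta\right).$$ Then $S$ is finite and integrable, $$\mathbb{E}_\epsilon S=\frac{\operatorname{tr}(G^{-1}H)}{Cn},$$ and for every $\delta\in(0,1]$, if $H\neq0$, $$\mathbb{P}_\epsilon\left(S\ge\frac{\operatorname{tr}(G^{-1}H)}{Cn}+\frac{\sqrt{\operatorname{tr}([G^{-1}H]^2)}}{Cn}\left(4\sqrt{2\log\tfrac1\delta}+64\log\tfrac1\delta\right)\right)\le\delta;$$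 if $H=0$ the same holds with "$\ge$" replaced by "$>$" in the event. \textbf{(2) Well-specified case.} Let $(X_1,Y_1),\dots,(X_n,Y_n)$ be i.i.d. copies of $(X,Y)$ with $Y=X^{\mathsf T}\beta^*+\xi$, $\mathbb{E}(X^{\mathsf T}\beta)^2<\infty$ for all $\beta\in\mathbb{R}^p$, $\mathbb{E}[\xi\mid X]=0$ and $\mathbb{E}[\xi^2\mid X]=\sigma^2$. Let $\mathcal F=\{x\mapsto x^{\mathsf T}\beta:\beta\in\mathbb{R}^p\}$ and let $\widehat f$ be the two-step (Star) estimator for $\mathcal F$: an empirical square-loss minimizer over the star hull $\{\lambda\widehat g+(1-\lambda)f: f\in\mathcal F,\lambda\in[0,1]\}$ of $\mathcal F$ around an empirical square-loss minimizer $\widehat g$ over $\mathcal F$. Let $\mathcal E(g)=\mathbb{E}(g(X)-Y)^2-\inf_{f\in\mathcal F}\mathbb{E}(f(X)-Y)^2$ be the excess loss. For $\eta<1$ let $L_\eta$ be the lower isometry event that $\frac1n\sum_{i=1}^n f(X_i)^2\ge(1-\eta)\,\mathbb{E}f(X)^2$ for all $f\in\mathcal F$. Conditionally on the design $(X_1,\dots,X_n)$,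 for almost every design with $G$ invertible: (a) $\mathbb{E}[G^{-1}H]=\sigma^2I_p$ and $\mathbb{E}\,\mathbb{E}_\epsilon S=\dfrac{\sigma^2p}{Cn}$; (b) the expected excess loss of $\widehat f$ over $\mathcal F$ for fresh responses at the design points, averaged over the $n$ points, is at most $\dfrac{\sigma^2p}{n}$; (c) for every $\eta<1$ for which the design satisfies $L_\eta$, $\;\mathbb{E}\,\mathcal E(\widehat f)\le\dfrac{1}{1-\eta}\cdot\dfrac{\sigma^2p}{n}$. Moreover, if $\mathbb{E}(X^{\mathsf T}\beta)^2>0$ for all $\beta\ne0$, and if $\eta<1$, $t>0$ and $\delta$ are such that $\mathbb{P}(L_\eta)\ge1-\delta$, then $$\mathbb{P}\left(\mathcal E(\widehat f)>\frac{1}{(1-\eta)\,t}\cdot\frac{\sigma^2p}{n}\right)\le\delta+t .$$ -/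

import Mathlib

open MeasureTheory ProbabilityTheory Matrix
open scoped ENNReal

noncomputable section

namespace OffsetRegression

/-- `ε 1, …, ε n` are i.i.d. Rademacher random variables on `(Ω, P)`: independent, each taking
the values `1` and `-1` with probability `1/2`. -/
def IsRademacher {Ω : Type*} [MeasurableSpace Ω] {n : ℕ} (ε : Fin n → Ω → ℝ) (P : Measure Ω) :
    Prop :=
  iIndepFun ε P ∧
    ∀ i, HasLaw (ε i) ((2⁻¹ : ℝ≥0∞) • Measure.dirac (1 : ℝ) + (2⁻¹ : ℝ≥0∞) • Measure.dirac (-1)) P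

/-- The Gram matrix `G = ∑ i, Xᵢ Xᵢᵀ`. -/
def gram {n p : ℕ} (X : Fin n → Fin p → ℝ) : Matrix (Fin p) (Fin p) ℝ :=
  ∑ i, vecMulVec (X i) (X i)

/-- The noise-weighted Gram matrix `H = ∑ i, ξᵢ² Xᵢ Xᵢᵀ`. -/
def noiseGram {n p : ℕ} (X : Fin n → Fin p → ℝ) (ξ : Fin n → ℝ) : Matrix (Fin p) (Fin p) ℝ :=
  ∑ i, ξ i ^ 2 • vecMulVec (X i) (X i)

/-- The offset Rademacher process of the linear class at `β`, for the signs `e`: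
`(1/n) ∑ i, (2 eᵢ ξᵢ Xᵢᵀ β - C βᵀ Xᵢ Xᵢᵀ β)`. -/
def offsetProcess {n p : ℕ} (C : ℝ) (X : Fin n → Fin p → ℝ) (ξ e : Fin n → ℝ) (β : Fin p → ℝ) :
    ℝ :=
  (1 / (n : ℝ)) * ∑ i, (2 * e i * ξ i * (X i ⬝ᵥ β) - C * (β ⬝ᵥ (vecMulVec (X i) (X i) *ᵥ β)))

/-- The supremum over `β ∈ ℝᵖ` of the offset Rademacher process. -/
def offsetSup {n p : ℕ} (C : ℝ) (X : Fin n → Fin p → ℝ) (ξ e : Fin n → ℝ) : ℝ :=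
  ⨆ β : Fin p → ℝ, offsetProcess C X ξ e β

/-- The class of linear functions `x ↦ xᵀ β` on `ℝᵖ`. -/
def linearClass (p : ℕ) : Set ((Fin p → ℝ) → ℝ) :=
  {f | ∃ β : Fin p → ℝ, ∀ x, f x = x ⬝ᵥ β}

section Estimator

variable {𝒳 : Type*}

/-- The star hull of `F` around `g`. -/
def starHull (F : Set (𝒳 → ℝ)) (g : 𝒳 → ℝ) : Set (𝒳 → ℝ) :=
  {h | ∃ f ∈ F, ∃ t ∈ Set.Icc (0 : ℝ) 1, h = t • g + (1 - t) • f}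

/-- The empirical square loss of `f` on the sample `(x i, y i)`. -/
def empRisk {n : ℕ} (x : Fin n → 𝒳) (y : Fin n → ℝ) (f : 𝒳 → ℝ) : ℝ :=
  (1 / (n : ℝ)) * ∑ i, (f (x i) - y i) ^ 2

/-- `f` is an empirical square-loss minimizer over `F`. -/
def IsEmpMin {n : ℕ} (F : Set (𝒳 → ℝ)) (x : Fin n → 𝒳) (y : Fin n → ℝ) (f : 𝒳 → ℝ) : Prop :=
  f ∈ F ∧ ∀ h ∈ F, empRisk x y f ≤ empRisk x y h

/-- `f` is the output of the two-step (Star) estimator for the class `F`: an empirical minimizer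
over the star hull of `F` around an empirical minimizer over `F`. -/
def IsStarEstimator {n : ℕ} (F : Set (𝒳 → ℝ)) (x : Fin n → 𝒳) (y : Fin n → ℝ) (f : 𝒳 → ℝ) :
    Prop :=
  ∃ g, IsEmpMin F x y g ∧ IsEmpMin (starHull F g) x y f

variable [MeasurableSpace 𝒳]

/-- The excess loss `E (g(X) - Y)² - inf_{f ∈ F} E (f(X) - Y)²` for `(X, Y)` with law `μ`. -/
def excessLoss (μ : Measure (𝒳 × ℝ)) (F : Set (𝒳 → ℝ)) (g : 𝒳 → ℝ) : ℝ :=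
  (∫ z, (g z.1 - z.2) ^ 2 ∂μ) - ⨅ f : F, ∫ z, (f.1 z.1 - z.2) ^ 2 ∂μ

/-- The lower isometry inequality with parameter `η` for the class `F` on the design `x`:
`(1/n) ∑ i, f(xᵢ)² ≥ (1 - η) E f²` for every `f ∈ F`. -/
def LowerIsometry {n : ℕ} (Q : Measure 𝒳) (F : Set (𝒳 → ℝ)) (η : ℝ) (x : Fin n → 𝒳) : Prop :=
  ∀ f ∈ F, (1 - η) * ∫ z, f z ^ 2 ∂Q ≤ (1 / (n : ℝ)) * ∑ i, f (x i) ^ 2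

end Estimator

/-- The responses `Yᵢ = Xᵢᵀ β* + ξᵢ`. -/
def responses {n p : ℕ} (X : Fin n → Fin p → ℝ) (βs : Fin p → ℝ) (ξ : Fin n → ℝ) : Fin n → ℝ :=
  fun i => X i ⬝ᵥ βs + ξ i

/-- The law of `(X, Y)` where `X` has law `Q`, the noise `ξ` has conditional law `κ X` given `X`,
and `Y = Xᵀ β* + ξ`. -/
def dataLaw {p : ℕ} (Q : Measure (Fin p → ℝ)) (κ : Kernel (Fin p → ℝ) ℝ) (βs : Fin p → ℝ) :
    Measure ((Fin p → ℝ) × ℝ) :=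
  (Q ⊗ₘ κ).map fun z => (z.1, z.1 ⬝ᵥ βs + z.2)

/-- The noise is conditionally centered with conditional variance `σ²`, given the covariate. -/
def WellSpecified {p : ℕ} (Q : Measure (Fin p → ℝ)) (κ : Kernel (Fin p → ℝ) ℝ) (σ : ℝ) : Prop :=
  ∀ᵐ x ∂Q, MemLp (fun e : ℝ => e) 2 (κ x) ∧ ∫ e, e ∂(κ x) = 0 ∧ ∫ e, e ^ 2 ∂(κ x) = σ ^ 2

/-- The conditional law of the noise vector `(ξ₁, …, ξₙ)` of an i.i.d. sample, given the design. -/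
def noiseLaw {n p : ℕ} (κ : Kernel (Fin p → ℝ) ℝ) (x : Fin n → Fin p → ℝ) :
    Measure (Fin n → ℝ) :=
  Measure.pi fun i => κ (x i)

/-- The square loss of `g` for predicting fresh responses at the fixed design points `xᵢ`. -/
def fixedDesignRisk {n p : ℕ} (κ : Kernel (Fin p → ℝ) ℝ) (βs : Fin p → ℝ)
    (x : Fin n → Fin p → ℝ) (g : (Fin p → ℝ) → ℝ) : ℝ :=
  (1 / (n : ℝ)) * ∑ i, ∫ e, (g (x i) - (x i ⬝ᵥ βs + e)) ^ 2 ∂(κ (x i))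

/-- The excess loss over the linear class for fresh responses at the fixed design points `xᵢ`. -/
def fixedDesignExcess {n p : ℕ} (κ : Kernel (Fin p → ℝ) ℝ) (βs : Fin p → ℝ)
    (x : Fin n → Fin p → ℝ) (g : (Fin p → ℝ) → ℝ) : ℝ :=
  fixedDesignRisk κ βs x g - ⨅ f : linearClass p, fixedDesignRisk κ βs x f.1

end OffsetRegression

end

open OffsetRegression

/-!
The supremum over `β` of the offset process is that of a concave quadratic, attained by completing
the square, and equals `vᵀ G⁻¹ v / (C n)` with `v = ∑ εᵢ ξᵢ Xᵢ` (`isGreatest_offsetProcess`). This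
is a Rademacher chaos `∑ᵢⱼ Mᵢⱼ εᵢ εⱼ` with `Mᵢⱼ = ξᵢ ξⱼ Xᵢᵀ G⁻¹ Xⱼ`, where `tr M = tr (G⁻¹ H)` and
the squared Frobenius norm of `M` is `tr ((G⁻¹ H)²)`. Its mean is `tr M` since the signs are
centred, independent and of unit variance.

The deviation bound is Chernoff's inequality for the estimate
`E exp (εᵀ M ε - tr M) ≤ exp (2 ‖M‖²)`, valid for symmetric `M` of Frobenius norm at most `1 / 8`
(`lintegral_exp_chaos_le`). It is proved without decoupling or comparison with Gaussians, by
induction on the number of signs: averaging over one sign replaces a linear term by half its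
square, hence `M` by a rank-one update of its remaining block, and in this range the growth of the
norm is paid for by the removed row. When `H ≠ 0` the matrix `M` is nonzero, and the bound holds
with a non-strict inequality in the event; when `H = 0` the supremum vanishes almost surely.

In the well-specified case the linear class is a vector space, so its star hull around any of its
members is the class itself and the Star estimator is least squares, whose coefficient error is
`u = G⁻¹ ∑ ξᵢ Xᵢ` (`IsEmpMin.eq_dotProduct`). The excess loss for fresh responses at the design
points is `uᵀ G u / n`, a quadratic form in the noise whose conditional mean is
`σ² tr (G⁻¹ G) / n = σ² p / n`; the population excess loss is `E (Xᵀ u)²`, which the lower isometry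
compares with `uᵀ G u / n`. For the unconditional bound the law of the sample is disintegrated
along the design (`pi_dataLaw_eq_map`). On the lower isometry event non-degeneracy of `X` makes `G`
invertible, and Markov's inequality is applied conditionally on the design.
-/

namespace OffsetRegression

/-! ### The exponential moment of a Rademacher chaos -/

/-- The Rademacher distribution on `ℝ`. -/
noncomputable def rademacherLaw : Measure ℝ :=
  (2⁻¹ : ℝ≥0∞) • Measure.dirac (1 : ℝ) + (2⁻¹ : ℝ≥0∞) • Measure.dirac (-1)

instance : IsProbabilityMeasure rademacherLaw where
  measure_univ := by simp [rademacherLaw, ENNReal.inv_two_add_inv_two]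

lemma IsRademacher.hasLaw_pi {Ω : Type*} [MeasurableSpace Ω] {P : Measure Ω} {n : ℕ}
    {ε : Fin n → Ω → ℝ} (hε : IsRademacher ε P) :
    HasLaw (fun ω i => ε i ω) (Measure.pi fun _ : Fin n => rademacherLaw) P :=
  iIndepFun.hasLaw_pi hε.2 hε.1

lemma lintegral_rademacherLaw {f : ℝ → ℝ≥0∞} (hf : Measurable f) :
    ∫⁻ x, f x ∂rademacherLaw = 2⁻¹ * f 1 + 2⁻¹ * f (-1) := by
  simp [rademacherLaw, lintegral_add_measure, lintegral_dirac' _ hf]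

lemma lintegral_pi_fin_succ {n : ℕ} (ν : Measure ℝ) [IsProbabilityMeasure ν]
    {f : (Fin (n + 1) → ℝ) → ℝ≥0∞} (hf : Measurable f) :
    ∫⁻ e, f e ∂(Measure.pi fun _ => ν)
      = ∫⁻ e', ∫⁻ x, f (Fin.cons x e') ∂ν ∂(Measure.pi fun _ => ν) := by
  have h := (measurePreserving_piFinSuccAbove (fun _ : Fin (n + 1) => ν) 0).symm
  rw [← h.lintegral_comp hf]
  have hm : Measurable fun z : ℝ × (Fin n → ℝ) =>
      f ((MeasurableEquiv.piFinSuccAbove (fun _ => ℝ) 0).symm z) := hf.comp (by fun_prop)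
  rw [lintegral_prod_symm' _ hm]
  simp only [MeasurableEquiv.piFinSuccAbove_symm_apply, Fin.insertNthEquiv_zero]
  rfl

/-- Averaging the exponential of a quadratic form over one sign: the first sign enters only
linearly, so `cosh x ≤ exp (x² / 2)` turns it into a rank-one perturbation of the quadratic form
in the remaining signs. -/
lemma rademacherLaw_step (a q : ℝ) :
    2⁻¹ * ENNReal.ofReal (Real.exp (q + 2 * a)) + 2⁻¹ * ENNReal.ofReal (Real.exp (q - 2 * a))
      ≤ ENNReal.ofReal (Real.exp (q + 2 * a ^ 2)) := by
  have h2 : (2⁻¹ : ℝ≥0∞) = ENNReal.ofReal (2⁻¹) := by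
    rw [ENNReal.ofReal_inv_of_pos (by norm_num)]; simp
  rw [h2, ← ENNReal.ofReal_mul (by norm_num), ← ENNReal.ofReal_mul (by norm_num),
    ← ENNReal.ofReal_add (by positivity) (by positivity)]
  apply ENNReal.ofReal_le_ofReal
  have h := Real.cosh_le_exp_half_sq (2 * a)
  rw [Real.cosh_eq] at h
  have h' : (2 * a) ^ 2 / 2 = 2 * a ^ 2 := by ring
  rw [h'] at h
  rw [Real.exp_add, sub_eq_add_neg, Real.exp_add, Real.exp_add]
  nlinarith [Real.exp_pos q]

/-- The rank-one update `M + 2 b bᵀ` increases the squared Frobenius norm by little when `M` and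
`b` are small. -/
lemma sum_sq_add_rankOne_le {n : ℕ} (M : Fin n → Fin n → ℝ) (b : Fin n → ℝ)
    (hM : ∑ i, ∑ j, M i j ^ 2 + 2 * ∑ i, b i ^ 2 ≤ 1 / 64) :
    ∑ i, ∑ j, (M i j + 2 * (b i * b j)) ^ 2
      ≤ ∑ i, ∑ j, M i j ^ 2 + (17 / 32) * ∑ i, b i ^ 2 := by
  set F := ∑ i, ∑ j, M i j ^ 2 with hF
  set β := ∑ i, b i ^ 2 with hβ
  set c := ∑ i, ∑ j, M i j * (b i * b j) with hc
  have hF0 : 0 ≤ F := by positivity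
  have hβ0 : 0 ≤ β := by positivity
  have hbb : ∑ i, ∑ j, (b i * b j) ^ 2 = β ^ 2 := by
    simp_rw [mul_pow, ← Finset.mul_sum, ← Finset.sum_mul]
    rw [← hβ]; ring
  have hexp : ∑ i, ∑ j, (M i j + 2 * (b i * b j)) ^ 2 = F + 4 * c + 4 * β ^ 2 := by
    rw [← hbb, hF, hc]
    simp_rw [Finset.mul_sum, ← Finset.sum_add_distrib]
    refine Finset.sum_congr rfl fun i _ => Finset.sum_congr rfl fun j _ => by ring
  have hCS : c ^ 2 ≤ F * β ^ 2 := by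
    have := Finset.sum_mul_sq_le_sq_mul_sq (Finset.univ : Finset (Fin n × Fin n))
      (fun z => M z.1 z.2) (fun z => b z.1 * b z.2)
    simp_rw [Fintype.sum_prod_type] at this
    rwa [hbb] at this
  have hc8 : c ≤ β / 8 := by
    apply le_of_sq_le_sq _ (by positivity)
    nlinarith [mul_nonneg hβ0 hβ0]
  rw [hexp]
  nlinarith

lemma measurable_chaos {n : ℕ} (M : Fin n → Fin n → ℝ) :
    Measurable fun e : Fin n → ℝ =>
      ENNReal.ofReal (Real.exp (∑ i, ∑ j, M i j * (e i * e j) - ∑ i, M i i)) := by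
  fun_prop

/-- The exponential moment of the centred Rademacher chaos `eᵀ M e - tr M` of a symmetric matrix
with small Frobenius norm, by induction on the number of signs. -/
theorem lintegral_exp_chaos_le {n : ℕ} (M : Fin n → Fin n → ℝ) (hsymm : ∀ i j, M i j = M j i)
    (hM : ∑ i, ∑ j, M i j ^ 2 ≤ 1 / 64) :
    ∫⁻ e, ENNReal.ofReal (Real.exp (∑ i, ∑ j, M i j * (e i * e j) - ∑ i, M i i))
        ∂(Measure.pi fun _ : Fin n => rademacherLaw)
      ≤ ENNReal.ofReal (Real.exp (2 * ∑ i, ∑ j, M i j ^ 2)) := by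
  induction n with
  | zero => simp
  | succ n ih =>
    set b : Fin n → ℝ := fun i => M 0 i.succ with hb
    set M' : Fin n → Fin n → ℝ := fun i j => M i.succ j.succ with hM'
    set β := ∑ i, b i ^ 2 with hβ
    have hF : ∑ i, ∑ j, M i j ^ 2 = M 0 0 ^ 2 + 2 * β + ∑ i, ∑ j, M' i j ^ 2 := by
      have hs : ∑ i : Fin n, M i.succ 0 ^ 2 = β :=
        Finset.sum_congr rfl fun i _ => by rw [hsymm]
      simp_rw [Fin.sum_univ_succ, Finset.sum_add_distrib, hs, hM', hβ, hb]
      ring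
    have hβ0 : 0 ≤ β := by positivity
    have hsmall : ∑ i, ∑ j, M' i j ^ 2 + 2 * β ≤ 1 / 64 := by nlinarith [sq_nonneg (M 0 0)]
    have hupd := sum_sq_add_rankOne_le M' b hsmall
    have hih := ih (fun i j => M' i j + 2 * (b i * b j))
      (fun i j => by simp only [hM']; rw [hsymm, mul_comm (b i)]) (by linarith)
    rw [lintegral_pi_fin_succ _ (measurable_chaos M)]
    have hstep : ∀ e' : Fin n → ℝ,
        ∫⁻ x, ENNReal.ofReal (Real.exp (∑ i, ∑ j, M i j *
            ((Fin.cons x e' : Fin (n + 1) → ℝ) i * (Fin.cons x e' : Fin (n + 1) → ℝ) j)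
            - ∑ i, M i i)) ∂rademacherLaw
          ≤ ENNReal.ofReal (Real.exp (2 * β)) *
            ENNReal.ofReal (Real.exp (∑ i, ∑ j, (M' i j + 2 * (b i * b j)) * (e' i * e' j)
              - ∑ i, (M' i i + 2 * (b i * b i)))) := by
      intro e'
      set a := ∑ i, b i * e' i with ha
      set q := ∑ i, ∑ j, M' i j * (e' i * e' j) - ∑ i, M' i i with hq
      have hval : ∀ x : ℝ, ∑ i, ∑ j, M i j *
            ((Fin.cons x e' : Fin (n + 1) → ℝ) i * (Fin.cons x e' : Fin (n + 1) → ℝ) j)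
            - ∑ i, M i i = M 0 0 * (x ^ 2 - 1) + 2 * x * a + q := by
        intro x
        have hs : ∑ i : Fin n, M i.succ 0 * (e' i * x) = x * a := by
          rw [ha, Finset.mul_sum]
          refine Finset.sum_congr rfl fun i _ => by rw [hsymm]; simp only [hb]; ring
        have hs' : ∑ i : Fin n, M 0 i.succ * (x * e' i) = x * a := by
          rw [ha, Finset.mul_sum]
          refine Finset.sum_congr rfl fun i _ => by simp only [hb]; ring
        simp_rw [Fin.sum_univ_succ, Fin.cons_zero, Fin.cons_succ, Finset.sum_add_distrib, hs, hs',
          hq, hM']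
        ring
      simp_rw [hval]
      rw [lintegral_rademacherLaw (by fun_prop), ← ENNReal.ofReal_mul (Real.exp_pos _).le,
        ← Real.exp_add]
      have hq' : 2 * β + (∑ i, ∑ j, (M' i j + 2 * (b i * b j)) * (e' i * e' j)
              - ∑ i, (M' i i + 2 * (b i * b i))) = q + 2 * a ^ 2 := by
        have h1 : ∑ i, ∑ j, (b i * b j) * (e' i * e' j) = a ^ 2 := by
          rw [ha, sq, Finset.sum_mul_sum]
          refine Finset.sum_congr rfl fun i _ => Finset.sum_congr rfl fun j _ => by ring
        have h2 : ∑ i, b i * b i = β := by simp_rw [hβ, sq]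
        simp_rw [add_mul, Finset.sum_add_distrib, mul_assoc (2 : ℝ), ← Finset.mul_sum, h1, h2, hq]
        ring
      rw [hq']
      convert rademacherLaw_step a q using 5 <;> ring
    refine (lintegral_mono hstep).trans ?_
    rw [lintegral_const_mul _ (measurable_chaos _)]
    refine (mul_le_mul_right hih _).trans ?_
    rw [← ENNReal.ofReal_mul (Real.exp_pos _).le, ← Real.exp_add]
    apply ENNReal.ofReal_le_ofReal
    apply Real.exp_le_exp.2
    rw [hF]
    nlinarith [sq_nonneg (M 0 0)]

/-- Chernoff bound for the Rademacher chaos, for an exponent `u` in units of the inverse Frobenius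
norm `1 / F`. -/
lemma measure_chaos_ge_le {n : ℕ} (M : Fin n → Fin n → ℝ) (hsymm : ∀ i j, M i j = M j i)
    {F : ℝ} (hF : 0 < F) (hMF : ∑ i, ∑ j, M i j ^ 2 = F ^ 2) {u : ℝ} (hu0 : 0 ≤ u)
    (hu : u ≤ 1 / 8) (s : ℝ) :
    (Measure.pi fun _ : Fin n => rademacherLaw)
        {e | ∑ i, M i i + F * s ≤ ∑ i, ∑ j, M i j * (e i * e j)}
      ≤ ENNReal.ofReal (Real.exp (2 * u ^ 2 - u * s)) := by
  set l := u / F with hl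
  have hscale : ∑ i, ∑ j, (l * M i j) ^ 2 = u ^ 2 := by
    simp_rw [mul_pow, ← Finset.mul_sum, hMF, hl]
    field_simp
  have hmgf := lintegral_exp_chaos_le (fun i j => l * M i j) (fun i j => by rw [hsymm])
    (by rw [hscale]; nlinarith)
  rw [hscale] at hmgf
  have hmark := meas_ge_le_lintegral_div
    (μ := Measure.pi fun _ : Fin n => rademacherLaw)
    (measurable_chaos fun i j => l * M i j).aemeasurable (ε := ENNReal.ofReal (Real.exp (u * s)))
    (by simp [Real.exp_pos]) (by simp)
  refine (measure_mono ?_).trans (hmark.trans ?_)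
  · intro e he
    simp only [Set.mem_ofPred_eq] at he ⊢
    apply ENNReal.ofReal_le_ofReal
    apply Real.exp_le_exp.2
    simp_rw [mul_assoc l, ← Finset.mul_sum, ← mul_sub]
    calc u * s = l * (F * s) := by rw [hl]; field_simp
      _ ≤ _ := by
        apply mul_le_mul_of_nonneg_left _ (by positivity)
        linarith
  · rw [ENNReal.div_le_iff (by simp [Real.exp_pos]) (by simp),
      ← ENNReal.ofReal_mul (Real.exp_pos _).le, ← Real.exp_add]
    simpa using hmgf

/-- Deviation inequality for a Rademacher chaos of order two. -/
theorem measure_chaos_deviation_le {n : ℕ} (M : Fin n → Fin n → ℝ)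
    (hsymm : ∀ i j, M i j = M j i) {F : ℝ} (hF : 0 < F) (hMF : ∑ i, ∑ j, M i j ^ 2 = F ^ 2)
    {δ : ℝ} (hδ0 : 0 < δ) (hδ1 : δ ≤ 1) :
    (Measure.pi fun _ : Fin n => rademacherLaw)
        {e | ∑ i, M i i + F * (4 * √(2 * Real.log (1 / δ)) + 64 * Real.log (1 / δ))
          ≤ ∑ i, ∑ j, M i j * (e i * e j)}
      ≤ ENNReal.ofReal δ := by
  set L := Real.log (1 / δ) with hL
  have hL0 : 0 ≤ L := Real.log_nonneg (by rw [le_div_iff₀ hδ0]; linarith)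
  have hδL : δ = Real.exp (-L) := by
    rw [hL, one_div, Real.log_inv, neg_neg, Real.exp_log hδ0]
  rw [hδL]
  set r := √(2 * L) with hr
  have hr0 : 0 ≤ r := Real.sqrt_nonneg _
  have hr2 : r ^ 2 = 2 * L := Real.sq_sqrt (by positivity)
  -- the exponent `√(L / 2)` is admissible for small `L` only; beyond that `1 / 8` suffices
  rcases le_total r (1 / 4) with h | h
  · refine (measure_chaos_ge_le M hsymm hF hMF (u := r / 2) (by positivity) (by linarith) _).trans
      (ENNReal.ofReal_le_ofReal (Real.exp_le_exp.2 ?_))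
    nlinarith
  · refine (measure_chaos_ge_le M hsymm hF hMF (u := 1 / 8) (by positivity) le_rfl _).trans
      (ENNReal.ofReal_le_ofReal (Real.exp_le_exp.2 ?_))
    nlinarith

/-! ### The Gram matrix and the supremum of the offset process -/

variable {n p : ℕ}

/-- The vector `∑ aᵢ Xᵢ`. -/
def weightedSum (X : Fin n → Fin p → ℝ) (a : Fin n → ℝ) : Fin p → ℝ := ∑ i, a i • X i

/-- The entry `Xᵢᵀ G⁻¹ Xⱼ` of the hat matrix. -/
noncomputable def hatEntry (X : Fin n → Fin p → ℝ) (i j : Fin n) : ℝ :=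
  X i ⬝ᵥ ((gram X)⁻¹ *ᵥ X j)

/-- The quadratic form `aᵀ A a` of the hat matrix `A = (Xᵢᵀ G⁻¹ Xⱼ)ᵢⱼ`. -/
noncomputable def hatForm (X : Fin n → Fin p → ℝ) (a : Fin n → ℝ) : ℝ :=
  ∑ i, ∑ j, hatEntry X i j * (a i * a j)

lemma gram_mulVec (X : Fin n → Fin p → ℝ) (β : Fin p → ℝ) :
    gram X *ᵥ β = weightedSum X fun i => X i ⬝ᵥ β := by
  rw [gram, Matrix.sum_mulVec, weightedSum]
  refine Finset.sum_congr rfl fun i _ => ?_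
  rw [vecMulVec_mulVec]
  ext k
  simp [mul_comm]

lemma weightedSum_dotProduct (X : Fin n → Fin p → ℝ) (a : Fin n → ℝ) (β : Fin p → ℝ) :
    weightedSum X a ⬝ᵥ β = ∑ i, a i * (X i ⬝ᵥ β) := by
  simp [weightedSum, sum_dotProduct]

lemma gram_transpose (X : Fin n → Fin p → ℝ) : (gram X)ᵀ = gram X := by
  simp [gram, transpose_sum, transpose_vecMulVec]

lemma dotProduct_gram_mulVec (X : Fin n → Fin p → ℝ) (β : Fin p → ℝ) :
    β ⬝ᵥ (gram X *ᵥ β) = ∑ i, (X i ⬝ᵥ β) ^ 2 := by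
  rw [gram_mulVec, dotProduct_comm, weightedSum_dotProduct]
  exact Finset.sum_congr rfl fun i _ => (sq _).symm

lemma gram_mulVec_inv {X : Fin n → Fin p → ℝ} (hG : IsUnit (gram X).det) (v : Fin p → ℝ) :
    gram X *ᵥ ((gram X)⁻¹ *ᵥ v) = v := by
  rw [mulVec_mulVec, mul_nonsing_inv _ hG, one_mulVec]

lemma hatEntry_comm (X : Fin n → Fin p → ℝ) (i j : Fin n) : hatEntry X i j = hatEntry X j i := by
  have h : ((gram X)⁻¹)ᵀ = (gram X)⁻¹ := by rw [transpose_nonsing_inv, gram_transpose]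
  rw [hatEntry, hatEntry, dotProduct_mulVec, ← mulVec_transpose, h, dotProduct_comm]

lemma hatForm_eq (X : Fin n → Fin p → ℝ) (a : Fin n → ℝ) :
    hatForm X a = weightedSum X a ⬝ᵥ ((gram X)⁻¹ *ᵥ weightedSum X a) := by
  rw [weightedSum_dotProduct, hatForm]
  refine Finset.sum_congr rfl fun i _ => ?_
  rw [weightedSum, mulVec_sum, dotProduct_sum, Finset.mul_sum]
  refine Finset.sum_congr rfl fun j _ => ?_
  rw [mulVec_smul, dotProduct_smul, hatEntry, smul_eq_mul]
  ring

/-- The hat form is the squared empirical norm of the least squares fit to the responses `a`. -/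
lemma hatForm_eq_sum_sq {X : Fin n → Fin p → ℝ} (hG : IsUnit (gram X).det) (a : Fin n → ℝ) :
    hatForm X a = ∑ i, (X i ⬝ᵥ ((gram X)⁻¹ *ᵥ weightedSum X a)) ^ 2 := by
  rw [← dotProduct_gram_mulVec, gram_mulVec_inv hG, dotProduct_comm, hatForm_eq]

lemma offsetProcess_eq (C : ℝ) (X : Fin n → Fin p → ℝ) (ξ e : Fin n → ℝ) (β : Fin p → ℝ) :
    offsetProcess C X ξ e β = (1 / (n : ℝ)) *
      (2 * (weightedSum X (fun i => e i * ξ i) ⬝ᵥ β) - C * ∑ i, (X i ⬝ᵥ β) ^ 2) := by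
  rw [offsetProcess, weightedSum_dotProduct, Finset.sum_sub_distrib, Finset.mul_sum,
    Finset.mul_sum]
  congr 2
  · exact Finset.sum_congr rfl fun i _ => by ring
  · refine Finset.sum_congr rfl fun i _ => ?_
    rw [vecMulVec_mulVec, op_smul_eq_smul, dotProduct_smul, dotProduct_comm β, smul_eq_mul, sq]

/-- Completing the square at `β = G⁻¹ v / C`. -/
lemma isGreatest_offsetProcess {C : ℝ} (hC : 0 < C) {X : Fin n → Fin p → ℝ}
    (hG : IsUnit (gram X).det) (ξ e : Fin n → ℝ) :
    IsGreatest (Set.range (offsetProcess C X ξ e)) (hatForm X (fun i => e i * ξ i) / (C * n)) := by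
  set v := weightedSum X (fun i => e i * ξ i) with hv
  set w := (gram X)⁻¹ *ᵥ v with hw
  have hq : hatForm X (fun i => e i * ξ i) = ∑ i, (X i ⬝ᵥ w) ^ 2 := hatForm_eq_sum_sq hG _
  have hvβ : ∀ β, v ⬝ᵥ β = ∑ i, (X i ⬝ᵥ w) * (X i ⬝ᵥ β) := by
    intro β
    rw [← gram_mulVec_inv hG v, ← hw, gram_mulVec, weightedSum_dotProduct]
  have key : ∀ β, offsetProcess C X ξ e β = hatForm X (fun i => e i * ξ i) / (C * n)
      - (1 / (n : ℝ)) * (C * ∑ i, (X i ⬝ᵥ β - C⁻¹ * (X i ⬝ᵥ w)) ^ 2) := by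
    intro β
    have hexp : ∑ i, (X i ⬝ᵥ β - C⁻¹ * (X i ⬝ᵥ w)) ^ 2
        = ∑ i, (X i ⬝ᵥ β) ^ 2 - 2 * C⁻¹ * (v ⬝ᵥ β) + C⁻¹ ^ 2 * ∑ i, (X i ⬝ᵥ w) ^ 2 := by
      rw [hvβ, Finset.mul_sum, Finset.mul_sum, ← Finset.sum_sub_distrib, ← Finset.sum_add_distrib]
      exact Finset.sum_congr rfl fun i _ => by ring
    rw [offsetProcess_eq, hq, hexp]
    rcases eq_or_ne (n : ℝ) 0 with hn | hn
    · simp [hn]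
    · field_simp
      ring
  constructor
  · refine ⟨C⁻¹ • w, ?_⟩
    rw [key]
    simp
  · rintro _ ⟨β, rfl⟩
    rw [key]
    have : 0 ≤ (1 / (n : ℝ)) * (C * ∑ i, (X i ⬝ᵥ β - C⁻¹ * (X i ⬝ᵥ w)) ^ 2) := by positivity
    linarith

lemma offsetSup_eq {C : ℝ} (hC : 0 < C) {X : Fin n → Fin p → ℝ} (hG : IsUnit (gram X).det)
    (ξ e : Fin n → ℝ) : offsetSup C X ξ e = hatForm X (fun i => e i * ξ i) / (C * n) :=
  (isGreatest_offsetProcess hC hG ξ e).csSup_eq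

lemma inv_gram_mul_noiseGram (X : Fin n → Fin p → ℝ) (ξ : Fin n → ℝ) :
    (gram X)⁻¹ * noiseGram X ξ = ∑ i, ξ i ^ 2 • vecMulVec ((gram X)⁻¹ *ᵥ X i) (X i) := by
  simp [noiseGram, Finset.mul_sum, mul_vecMulVec]

lemma trace_inv_gram_mul_noiseGram (X : Fin n → Fin p → ℝ) (ξ : Fin n → ℝ) :
    ((gram X)⁻¹ * noiseGram X ξ).trace = ∑ i, hatEntry X i i * (ξ i * ξ i) := by
  rw [inv_gram_mul_noiseGram, trace_sum]
  refine Finset.sum_congr rfl fun i _ => ?_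
  rw [trace_smul, trace_vecMulVec, dotProduct_comm, hatEntry, smul_eq_mul]
  ring

lemma sum_hatEntry_self {X : Fin n → Fin p → ℝ} (hG : IsUnit (gram X).det) :
    ∑ i, hatEntry X i i = p := by
  have h := trace_inv_gram_mul_noiseGram X fun _ => 1
  have h1 : noiseGram X (fun _ => 1) = gram X := by simp [noiseGram, gram]
  rw [h1, nonsing_inv_mul _ hG, trace_one] at h
  simpa using h.symm

/-- `tr((G⁻¹ H)²)` is the squared Frobenius norm of the chaos matrix `ξᵢ ξⱼ Xᵢᵀ G⁻¹ Xⱼ`. -/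
lemma trace_inv_gram_mul_noiseGram_sq (X : Fin n → Fin p → ℝ) (ξ : Fin n → ℝ) :
    (((gram X)⁻¹ * noiseGram X ξ) ^ 2).trace
      = ∑ i, ∑ j, (hatEntry X i j * (ξ i * ξ j)) ^ 2 := by
  rw [inv_gram_mul_noiseGram, sq, Finset.sum_mul_sum, trace_sum]
  refine Finset.sum_congr rfl fun i _ => ?_
  rw [trace_sum]
  refine Finset.sum_congr rfl fun j _ => ?_
  rw [smul_mul_smul, vecMulVec_mul_vecMulVec, trace_smul, vecMulVec_smul, trace_smul,
    trace_vecMulVec, dotProduct_comm (((gram X)⁻¹ *ᵥ X i))]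
  change _ • (hatEntry X i j • hatEntry X j i) = _
  rw [hatEntry_comm X j i, smul_eq_mul, smul_eq_mul]
  ring

/-- The chaos matrix vanishes only if `H` does, because `G⁻¹` is positive definite. -/
lemma trace_sq_pos_of_noiseGram_ne_zero {X : Fin n → Fin p → ℝ} (hG : IsUnit (gram X).det)
    {ξ : Fin n → ℝ} (hH : noiseGram X ξ ≠ 0) :
    0 < (((gram X)⁻¹ * noiseGram X ξ) ^ 2).trace := by
  rw [trace_inv_gram_mul_noiseGram_sq]
  refine lt_of_le_of_ne (by positivity) fun h => hH ?_
  rw [noiseGram]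
  refine Finset.sum_eq_zero fun i _ => ?_
  have hi : hatEntry X i i * (ξ i * ξ i) = 0 := by
    have h1 := (Finset.sum_eq_zero_iff_of_nonneg fun i _ => by positivity).1 h.symm i
      (Finset.mem_univ i)
    have h2 := (Finset.sum_eq_zero_iff_of_nonneg fun j _ => by positivity).1 h1 i
      (Finset.mem_univ i)
    exact pow_eq_zero_iff (two_ne_zero) |>.1 h2
  rcases mul_eq_zero.1 hi with h0 | h0
  · have hsum : ∑ k, (X k ⬝ᵥ ((gram X)⁻¹ *ᵥ X i)) ^ 2 = 0 := by
      rw [← dotProduct_gram_mulVec, gram_mulVec_inv hG, dotProduct_comm]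
      exact h0
    have hX : X i = 0 := by
      rw [← gram_mulVec_inv hG (X i), gram_mulVec, weightedSum]
      refine Finset.sum_eq_zero fun k hk => ?_
      have := (Finset.sum_eq_zero_iff_of_nonneg fun k _ => by positivity).1 hsum k hk
      rw [pow_eq_zero_iff (two_ne_zero) |>.1 this, zero_smul]
    simp [hX]
  · have : ξ i = 0 := by simpa using h0
    simp [this]

lemma hatForm_nonneg {X : Fin n → Fin p → ℝ} (hG : IsUnit (gram X).det) (a : Fin n → ℝ) :
    0 ≤ hatForm X a := by
  rw [hatForm_eq_sum_sq hG]; positivity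

lemma hatForm_mul (X : Fin n → Fin p → ℝ) (ξ e : Fin n → ℝ) :
    hatForm X (fun i => e i * ξ i) = ∑ i, ∑ j, hatEntry X i j * (ξ i * ξ j) * (e i * e j) :=
  Finset.sum_congr rfl fun i _ => Finset.sum_congr rfl fun j _ => by ring

/-! ### Expectation of quadratic forms in independent centred variables -/

/-- A centred square integrable law with variance `v`. -/
structure IsCenteredWithVariance (ν : Measure ℝ) (v : ℝ) : Prop where
  memLp : MemLp (fun e : ℝ => e) 2 ν
  mean : ∫ e, e ∂ν = 0
  var : ∫ e, e ^ 2 ∂ν = v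

lemma isCenteredWithVariance_rademacherLaw : IsCenteredWithVariance rademacherLaw 1 := by
  have hi : ∀ {f : ℝ → ℝ}, Integrable f (Measure.dirac 1) ∧ Integrable f (Measure.dirac (-1)) :=
    fun {f} => ⟨integrable_dirac (by finiteness), integrable_dirac (by finiteness)⟩
  have hint : ∀ f : ℝ → ℝ, Integrable f rademacherLaw := fun f =>
    (hi.1.smul_measure (by simp)).add_measure (hi.2.smul_measure (by simp))
  have hval : ∀ f : ℝ → ℝ, ∫ x, f x ∂rademacherLaw = (f 1 + f (-1)) / 2 := by
    intro f
    rw [rademacherLaw, integral_add_measure (hi.1.smul_measure (by simp))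
      (hi.2.smul_measure (by simp)), integral_smul_measure, integral_smul_measure, integral_dirac,
      integral_dirac]
    simp
    ring
  refine ⟨(memLp_two_iff_integrable_sq (by fun_prop)).2 (hint _), ?_, ?_⟩
  · rw [hval]; norm_num
  · rw [hval]; norm_num

section QuadraticForm

variable {ν : Fin n → Measure ℝ} [∀ i, IsProbabilityMeasure (ν i)] {v : ℝ}

lemma integrable_eval_mul_eval (hν : ∀ i, IsCenteredWithVariance (ν i) v) (i j : Fin n) :
    Integrable (fun a : Fin n → ℝ => a i * a j) (Measure.pi ν) := by
  have h : ∀ i, MemLp (fun a : Fin n → ℝ => a i) 2 (Measure.pi ν) := fun i =>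
    (hν i).memLp.comp_measurePreserving (measurePreserving_eval ν i)
  exact (h i).integrable_mul (h j)

lemma integral_eval_mul_eval (hν : ∀ i, IsCenteredWithVariance (ν i) v) (i j : Fin n) :
    ∫ a, a i * a j ∂(Measure.pi ν) = if i = j then v else 0 := by
  split_ifs with hij
  · subst hij
    rw [← (hν i).var, ← integral_comp_eval (μ := ν) (i := i) (f := fun e => e ^ 2) (by fun_prop)]
    simp_rw [sq]
  · have hind : iIndepFun (fun i (a : Fin n → ℝ) => a i) (Measure.pi ν) :=
      iIndepFun_pi (X := fun _ e => e) fun _ => aemeasurable_id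
    rw [(hind.indepFun hij).integral_fun_mul_eq_mul_integral
        (measurable_pi_apply i).aestronglyMeasurable (measurable_pi_apply j).aestronglyMeasurable,
      integral_comp_eval (μ := ν) (i := i) (f := fun e => e) (by fun_prop), (hν i).mean, zero_mul]

lemma integrable_quadraticForm (hν : ∀ i, IsCenteredWithVariance (ν i) v)
    (A : Fin n → Fin n → ℝ) :
    Integrable (fun a : Fin n → ℝ => ∑ i, ∑ j, A i j * (a i * a j)) (Measure.pi ν) :=
  integrable_finsetSum _ fun i _ => integrable_finsetSum _ fun j _ =>
    (integrable_eval_mul_eval hν i j).const_mul _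

lemma integral_quadraticForm (hν : ∀ i, IsCenteredWithVariance (ν i) v)
    (A : Fin n → Fin n → ℝ) :
    ∫ a, ∑ i, ∑ j, A i j * (a i * a j) ∂(Measure.pi ν) = v * ∑ i, A i i := by
  have hint := fun i j => (integrable_eval_mul_eval hν i j).const_mul (A i j)
  rw [integral_finsetSum _ fun i _ => integrable_finsetSum _ fun j _ => hint i j, Finset.mul_sum]
  refine Finset.sum_congr rfl fun i _ => ?_
  rw [integral_finsetSum _ fun j _ => hint i j]
  simp_rw [integral_const_mul, integral_eval_mul_eval hν]
  simp [mul_comm]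

end QuadraticForm

/-! ### Fixed design and fixed noise -/

section Signs

variable {Ω : Type*} [MeasurableSpace Ω] {P : Measure Ω} {ε : Fin n → Ω → ℝ} {C : ℝ}
  {X : Fin n → Fin p → ℝ}

lemma IsRademacher.integrable_offsetSup (hε : IsRademacher ε P) (hC : 0 < C)
    (hG : IsUnit (gram X).det) (ξ : Fin n → ℝ) :
    Integrable (fun ω => offsetSup C X ξ (fun i => ε i ω)) P := by
  simp_rw [offsetSup_eq hC hG, hatForm_mul]
  have h := (integrable_quadraticForm (fun _ => isCenteredWithVariance_rademacherLaw)
    (fun i j : Fin n => hatEntry X i j * (ξ i * ξ j))).div_const (C * n)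
  rw [← hε.hasLaw_pi.map_eq] at h
  exact h.comp_aemeasurable hε.hasLaw_pi.aemeasurable

lemma IsRademacher.integral_offsetSup (hε : IsRademacher ε P) (hC : 0 < C)
    (hG : IsUnit (gram X).det) (ξ : Fin n → ℝ) :
    ∫ ω, offsetSup C X ξ (fun i => ε i ω) ∂P
      = ((gram X)⁻¹ * noiseGram X ξ).trace / (C * n) := by
  simp_rw [offsetSup_eq hC hG, hatForm_mul]
  have h := integral_quadraticForm (fun _ => isCenteredWithVariance_rademacherLaw)
    (fun i j : Fin n => hatEntry X i j * (ξ i * ξ j))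
  rw [one_mul, ← trace_inv_gram_mul_noiseGram, ← hε.hasLaw_pi.map_eq,
    integral_map hε.hasLaw_pi.aemeasurable (by fun_prop)] at h
  rw [integral_div, h]

lemma IsRademacher.measure_offsetSup_ge_le (hε : IsRademacher ε P) (hC : 0 < C)
    (hG : IsUnit (gram X).det) {ξ : Fin n → ℝ} (hH : noiseGram X ξ ≠ 0) {δ : ℝ} (hδ0 : 0 < δ)
    (hδ1 : δ ≤ 1) :
    P.real {ω | ((gram X)⁻¹ * noiseGram X ξ).trace / (C * n)
              + √((((gram X)⁻¹ * noiseGram X ξ) ^ 2).trace)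
                  / (C * n) * (4 * √(2 * Real.log (1 / δ)) + 64 * Real.log (1 / δ))
              ≤ offsetSup C X ξ (fun i => ε i ω)} ≤ δ := by
  have hn : 0 < (n : ℝ) := by
    rcases Nat.eq_zero_or_pos n with rfl | hn
    · exact absurd (by simp [noiseGram]) hH
    · exact_mod_cast hn
  have htr := trace_sq_pos_of_noiseGram_ne_zero hG hH
  set F := √((((gram X)⁻¹ * noiseGram X ξ) ^ 2).trace) with hF
  have hF2 : ∑ i, ∑ j, (hatEntry X i j * (ξ i * ξ j)) ^ 2 = F ^ 2 := by
    rw [hF, Real.sq_sqrt htr.le, trace_inv_gram_mul_noiseGram_sq]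
  have hdev := measure_chaos_deviation_le (fun i j => hatEntry X i j * (ξ i * ξ j))
    (fun i j => by rw [hatEntry_comm, mul_comm (ξ i)]) (Real.sqrt_pos.2 htr) hF2 hδ0 hδ1
  rw [← trace_inv_gram_mul_noiseGram, ← hε.hasLaw_pi.map_eq, Measure.map_apply_of_aemeasurable
    hε.hasLaw_pi.aemeasurable (measurableSet_le (by fun_prop) (by fun_prop))] at hdev
  refine ENNReal.toReal_le_of_le_ofReal hδ0.le ((measure_mono fun ω hω => ?_).trans hdev)
  simp only [Set.mem_ofPred_eq, Set.mem_preimage] at hω ⊢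
  rw [offsetSup_eq hC hG, hatForm_mul, le_div_iff₀ (by positivity)] at hω
  refine le_trans (le_of_eq ?_) hω
  rw [← hF]
  field_simp

/-- If `H = 0` then the supremum, being nonnegative with mean zero, vanishes almost surely. -/
lemma IsRademacher.measure_offsetSup_gt_le [IsProbabilityMeasure P] (hε : IsRademacher ε P)
    (hC : 0 < C) (hG : IsUnit (gram X).det) (ξ : Fin n → ℝ) {δ : ℝ} (hδ0 : 0 < δ) (hδ1 : δ ≤ 1) :
    P.real {ω | ((gram X)⁻¹ * noiseGram X ξ).trace / (C * n)
              + √((((gram X)⁻¹ * noiseGram X ξ) ^ 2).trace)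
                  / (C * n) * (4 * √(2 * Real.log (1 / δ)) + 64 * Real.log (1 / δ))
              < offsetSup C X ξ (fun i => ε i ω)} ≤ δ := by
  by_cases hH : noiseGram X ξ = 0
  · have hnn : 0 ≤ᵐ[P] fun ω => offsetSup C X ξ (fun i => ε i ω) := .of_forall fun ω => by
      simp only [Pi.zero_apply]
      rw [offsetSup_eq hC hG]
      exact div_nonneg (hatForm_nonneg hG _) (by positivity)
    have h0 : ∫ ω, offsetSup C X ξ (fun i => ε i ω) ∂P = 0 := by
      rw [hε.integral_offsetSup hC hG, hH]; simp
    rw [integral_eq_zero_iff_of_nonneg_ae hnn (hε.integrable_offsetSup hC hG ξ)] at h0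
    rw [hH, measureReal_def, measure_mono_null _ (ae_iff.1 h0)]
    · simpa using hδ0.le
    · intro ω hω
      simp only [Set.mem_ofPred_eq, mul_zero, trace_zero, ne_eq, zero_div, OfNat.ofNat_ne_zero,
        not_false_eq_true, zero_pow, Real.sqrt_zero, zero_mul, add_zero, Pi.zero_apply] at hω ⊢
      exact hω.ne'
  · refine le_trans (measureReal_mono (fun ω hω => ?_) (measure_ne_top _ _))
      (hε.measure_offsetSup_ge_le hC hG hH hδ0 hδ1)
    exact le_of_lt (Set.mem_ofPred_eq ▸ hω)

end Signs

/-! ### The Star estimator of a linear class is least squares -/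

/-- A linear class is closed under the segments that form the star hull. -/
lemma starHull_linearClass {g : (Fin p → ℝ) → ℝ} (hg : g ∈ linearClass p) :
    starHull (linearClass p) g = linearClass p := by
  obtain ⟨γ, hγ⟩ := hg
  refine Set.Subset.antisymm ?_ fun f hf => ⟨f, hf, 0, by simp, by simp⟩
  rintro _ ⟨f, ⟨β, hβ⟩, t, -, rfl⟩
  exact ⟨t • γ + (1 - t) • β, fun x => by simp [hγ, hβ, dotProduct_add]⟩

lemma IsStarEstimator.isEmpMin {x : Fin n → Fin p → ℝ} {y : Fin n → ℝ} {f : (Fin p → ℝ) → ℝ}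
    (hf : IsStarEstimator (linearClass p) x y f) : IsEmpMin (linearClass p) x y f := by
  obtain ⟨g, hg, hfg⟩ := hf
  rwa [starHull_linearClass hg.1] at hfg

/-- The error `G⁻¹ ∑ ξᵢ Xᵢ` of the least squares coefficient. -/
noncomputable def lsError (X : Fin n → Fin p → ℝ) (ξ : Fin n → ℝ) : Fin p → ℝ :=
  (gram X)⁻¹ *ᵥ weightedSum X ξ

lemma eq_zero_of_sum_sq_eq_zero {X : Fin n → Fin p → ℝ} (hG : IsUnit (gram X).det)
    {d : Fin p → ℝ} (h : ∑ i, (X i ⬝ᵥ d) ^ 2 ≤ 0) : d = 0 := by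
  have h0 : ∑ i, (X i ⬝ᵥ d) ^ 2 = 0 := le_antisymm h (by positivity)
  rw [Finset.sum_eq_zero_iff_of_nonneg fun i _ => by positivity] at h0
  have hGd : gram X *ᵥ d = 0 := by
    rw [gram_mulVec, weightedSum]
    exact Finset.sum_eq_zero fun i hi => by simp [pow_eq_zero_iff (two_ne_zero) |>.1 (h0 i hi)]
  rw [← one_mulVec d, ← nonsing_inv_mul _ hG, ← mulVec_mulVec, hGd, mulVec_zero]

/-- The empirical minimizer is unique when the Gram matrix is invertible. -/
lemma IsEmpMin.eq_dotProduct {x : Fin n → Fin p → ℝ} (hG : IsUnit (gram x).det)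
    {βs : Fin p → ℝ} {ξ : Fin n → ℝ} {f : (Fin p → ℝ) → ℝ}
    (hf : IsEmpMin (linearClass p) x (responses x βs ξ) f) :
    f = fun z => z ⬝ᵥ (βs + lsError x ξ) := by
  obtain ⟨⟨β, hβ⟩, hmin⟩ := hf
  set d := β - (βs + lsError x ξ) with hd
  have hmin' := hmin (fun z => z ⬝ᵥ (βs + lsError x ξ)) ⟨_, fun _ => rfl⟩
  -- the normal equations: the residuals are orthogonal to the design
  have horth : ∑ i, (x i ⬝ᵥ lsError x ξ - ξ i) * (x i ⬝ᵥ d) = 0 := by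
    simp_rw [sub_mul, Finset.sum_sub_distrib, ← weightedSum_dotProduct]
    rw [← gram_mulVec, lsError, gram_mulVec_inv hG, sub_self]
  have hpyth : ∑ i, (f (x i) - responses x βs ξ i) ^ 2
      = ∑ i, (x i ⬝ᵥ (βs + lsError x ξ) - responses x βs ξ i) ^ 2 + ∑ i, (x i ⬝ᵥ d) ^ 2 := by
    have h2 : ∑ i, 2 * ((x i ⬝ᵥ lsError x ξ - ξ i) * (x i ⬝ᵥ d)) = 0 := by
      rw [← Finset.mul_sum, horth, mul_zero]
    rw [← add_zero (∑ i, _ + ∑ i, _), ← h2, ← Finset.sum_add_distrib, ← Finset.sum_add_distrib]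
    refine Finset.sum_congr rfl fun i _ => ?_
    rw [hβ, hd, responses, dotProduct_sub, dotProduct_add]
    ring
  have hd0 : d = 0 := by
    refine eq_zero_of_sum_sq_eq_zero hG ?_
    rcases Nat.eq_zero_or_pos n with rfl | hn
    · simp
    · have hn' : 0 < 1 / (n : ℝ) := by positivity
      rw [empRisk, empRisk, hpyth] at hmin'
      have := le_of_mul_le_mul_left hmin' hn'
      linarith
  ext z
  rw [hβ, ← sub_eq_zero.1 hd0]

/-! ### Excess losses of a linear predictor -/

lemma IsCenteredWithVariance.integrable_sub_sq {ν : Measure ℝ} [IsProbabilityMeasure ν] {v : ℝ}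
    (h : IsCenteredWithVariance ν v) (a : ℝ) : Integrable (fun e => (a - e) ^ 2) ν :=
  ((memLp_const a).sub h.memLp).integrable_sq

lemma IsCenteredWithVariance.integral_sub_sq {ν : Measure ℝ} [IsProbabilityMeasure ν] {v : ℝ}
    (h : IsCenteredWithVariance ν v) (a : ℝ) : ∫ e, (a - e) ^ 2 ∂ν = a ^ 2 + v := by
  have h1 : Integrable (fun e : ℝ => e) ν := h.memLp.integrable one_le_two
  have h2 : Integrable (fun e : ℝ => e ^ 2) ν := h.memLp.integrable_sq
  have h3 : Integrable (fun e : ℝ => 2 * a * e) ν := h1.const_mul _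
  have h4 : Integrable (fun e : ℝ => a ^ 2 - 2 * a * e) ν := (integrable_const _).sub h3
  have : ∀ e : ℝ, (a - e) ^ 2 = a ^ 2 - 2 * a * e + e ^ 2 := fun e => by ring
  simp_rw [this]
  rw [integral_add h4 h2, integral_sub (integrable_const _) h3, integral_const_mul, h.mean, h.var]
  simp

lemma iInf_eq_of_isLeast {α : Type*} (F : α → ℝ) (a : α) (h : ∀ b, F a ≤ F b) :
    ⨅ b, F b = F a :=
  have : Nonempty α := ⟨a⟩
  le_antisymm (ciInf_le ⟨F a, by rintro _ ⟨b, rfl⟩; exact h b⟩ a) (le_ciInf h)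

/-- The infimum of a risk over the linear class when it is attained at the coefficient `βs`. -/
lemma iInf_linearClass_eq (R : ((Fin p → ℝ) → ℝ) → ℝ) (βs : Fin p → ℝ)
    (h : ∀ u, R (fun z => z ⬝ᵥ βs) ≤ R fun z => z ⬝ᵥ (βs + u)) :
    ⨅ f : linearClass p, R f.1 = R fun z => z ⬝ᵥ βs := by
  refine iInf_eq_of_isLeast (fun f : linearClass p => R f.1) ⟨_, βs, fun _ => rfl⟩ ?_
  rintro ⟨f, β, hf⟩
  obtain rfl : f = fun z => z ⬝ᵥ β := funext hf
  simpa using h (β - βs)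

section FixedDesign

variable {κ : Kernel (Fin p → ℝ) ℝ} [IsMarkovKernel κ] {σ : ℝ} {x : Fin n → Fin p → ℝ}

lemma fixedDesignRisk_dotProduct (hx : ∀ i, IsCenteredWithVariance (κ (x i)) (σ ^ 2))
    (βs u : Fin p → ℝ) :
    fixedDesignRisk κ βs x (fun z => z ⬝ᵥ (βs + u))
      = (1 / (n : ℝ)) * ∑ i, ((x i ⬝ᵥ u) ^ 2 + σ ^ 2) := by
  rw [fixedDesignRisk]
  congr 1
  refine Finset.sum_congr rfl fun i _ => ?_
  simp_rw [dotProduct_add, add_sub_add_left_eq_sub]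
  exact (hx i).integral_sub_sq _

lemma fixedDesignExcess_dotProduct (hx : ∀ i, IsCenteredWithVariance (κ (x i)) (σ ^ 2))
    (βs u : Fin p → ℝ) :
    fixedDesignExcess κ βs x (fun z => z ⬝ᵥ (βs + u)) = (1 / (n : ℝ)) * ∑ i, (x i ⬝ᵥ u) ^ 2 := by
  have h0 := fixedDesignRisk_dotProduct hx βs 0
  rw [add_zero] at h0
  rw [fixedDesignExcess, iInf_linearClass_eq (fixedDesignRisk κ βs x) βs, h0,
    fixedDesignRisk_dotProduct hx, ← mul_sub, ← Finset.sum_sub_distrib]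
  · simp
  · intro u
    rw [h0, fixedDesignRisk_dotProduct hx]
    simp only [dotProduct_zero]
    refine mul_le_mul_of_nonneg_left (Finset.sum_le_sum fun i _ => ?_) (by positivity)
    rw [zero_pow two_ne_zero, zero_add, le_add_iff_nonneg_left]
    exact sq_nonneg _

end FixedDesign

section Population

variable {Q : Measure (Fin p → ℝ)} {κ : Kernel (Fin p → ℝ) ℝ} {σ : ℝ}

lemma WellSpecified.ae_isCentered (hQ : WellSpecified Q κ σ) :
    ∀ᵐ x ∂Q, IsCenteredWithVariance (κ x) (σ ^ 2) := by
  filter_upwards [hQ] with x hx using ⟨hx.1, hx.2.1, hx.2.2⟩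

lemma WellSpecified.ae_pi_isCentered [IsProbabilityMeasure Q] (hQ : WellSpecified Q κ σ) :
    ∀ᵐ x ∂(Measure.pi fun _ : Fin n => Q), ∀ i, IsCenteredWithVariance (κ (x i)) (σ ^ 2) :=
  ae_all_iff.2 fun i =>
    (Measure.tendsto_eval_ae_ae (μ := fun _ : Fin n => Q) (i := i)).eventually hQ.ae_isCentered

lemma integral_dataLaw_dotProduct [IsProbabilityMeasure Q] [IsMarkovKernel κ]
    (hQ : WellSpecified Q κ σ)
    (hint : ∀ β : Fin p → ℝ, Integrable (fun x => (x ⬝ᵥ β) ^ 2) Q) (βs u : Fin p → ℝ) :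
    ∫ z, (z.1 ⬝ᵥ (βs + u) - z.2) ^ 2 ∂(dataLaw Q κ βs) = ∫ x, (x ⬝ᵥ u) ^ 2 ∂Q + σ ^ 2 := by
  have hlin : ∀ w : Fin p → ℝ, Measurable fun x : Fin p → ℝ => x ⬝ᵥ w := fun w => by
    unfold dotProduct; fun_prop
  have hlin' : ∀ w : Fin p → ℝ, Measurable fun z : (Fin p → ℝ) × ℝ => z.1 ⬝ᵥ w := fun w =>
    (hlin w).comp measurable_fst
  rw [dataLaw, integral_map (by fun_prop) (by fun_prop)]
  simp_rw [dotProduct_add, add_sub_add_left_eq_sub]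
  have hfib : ∀ᵐ x ∂Q, ∫ e, (x ⬝ᵥ u - e) ^ 2 ∂(κ x) = (x ⬝ᵥ u) ^ 2 + σ ^ 2 := by
    filter_upwards [hQ.ae_isCentered] with x hx using hx.integral_sub_sq _
  rw [Measure.integral_compProd, integral_congr_ae hfib, integral_add (hint u) (by fun_prop)]
  · simp
  · rw [Measure.integrable_compProd_iff (by fun_prop)]
    refine ⟨?_, ?_⟩
    · filter_upwards [hQ.ae_isCentered] with x hx using hx.integrable_sub_sq _
    · simp_rw [Real.norm_of_nonneg (sq_nonneg _)]
      exact ((hint u).add (integrable_const (σ ^ 2))).congr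
        (by filter_upwards [hfib] with x hx; exact hx.symm)

lemma excessLoss_dotProduct [IsProbabilityMeasure Q] [IsMarkovKernel κ]
    (hQ : WellSpecified Q κ σ)
    (hint : ∀ β : Fin p → ℝ, Integrable (fun x => (x ⬝ᵥ β) ^ 2) Q) (βs u : Fin p → ℝ) :
    excessLoss (dataLaw Q κ βs) (linearClass p) (fun z => z ⬝ᵥ (βs + u))
      = ∫ x, (x ⬝ᵥ u) ^ 2 ∂Q := by
  have h0 := integral_dataLaw_dotProduct hQ hint βs 0
  rw [add_zero] at h0
  rw [excessLoss,
    iInf_linearClass_eq (fun f => ∫ z, (f z.1 - z.2) ^ 2 ∂(dataLaw Q κ βs)) βs, h0,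
    integral_dataLaw_dotProduct hQ hint]
  · simp
  · intro u
    rw [h0, integral_dataLaw_dotProduct hQ hint]
    simp only [dotProduct_zero]
    rw [zero_pow two_ne_zero, integral_zero, zero_add, le_add_iff_nonneg_left]
    exact integral_nonneg fun _ => sq_nonneg _

/-- The population second moment is a quadratic form in the coefficient. -/
lemma integral_dotProduct_sq_eq_sum
    (hint : ∀ β : Fin p → ℝ, Integrable (fun x => (x ⬝ᵥ β) ^ 2) Q) (u : Fin p → ℝ) :
    ∫ x, (x ⬝ᵥ u) ^ 2 ∂Q = ∑ j, ∑ k, (∫ x, x j * x k ∂Q) * (u j * u k) := by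
  have hL : ∀ j, MemLp (fun x : Fin p → ℝ => x j) 2 Q := fun j => by
    rw [memLp_two_iff_integrable_sq (measurable_pi_apply j).aestronglyMeasurable]
    simpa using hint (Pi.single j 1)
  have hjk : ∀ j k, Integrable (fun x : Fin p → ℝ => x j * x k * (u j * u k)) Q := fun j k =>
    ((hL j).integrable_mul (hL k)).mul_const _
  have hsq : ∀ x : Fin p → ℝ, (x ⬝ᵥ u) ^ 2 = ∑ j, ∑ k, x j * x k * (u j * u k) := fun x => by
    rw [dotProduct, sq, Finset.sum_mul_sum]
    exact Finset.sum_congr rfl fun j _ => Finset.sum_congr rfl fun k _ => by ring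
  simp_rw [hsq]
  rw [integral_finsetSum _ fun j _ => integrable_finsetSum _ fun k _ => hjk j k]
  refine Finset.sum_congr rfl fun j _ => ?_
  rw [integral_finsetSum _ fun k _ => hjk j k]
  exact Finset.sum_congr rfl fun k _ => integral_mul_const _ _

lemma continuous_integral_dotProduct_sq
    (hint : ∀ β : Fin p → ℝ, Integrable (fun x => (x ⬝ᵥ β) ^ 2) Q) :
    Continuous fun u : Fin p → ℝ => ∫ x, (x ⬝ᵥ u) ^ 2 ∂Q := by
  simp_rw [integral_dotProduct_sq_eq_sum hint]
  fun_prop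

end Population

/-! ### Expectations conditionally on the design -/

section Conditional

variable {Q : Measure (Fin p → ℝ)} {κ : Kernel (Fin p → ℝ) ℝ}
  [IsMarkovKernel κ] {σ : ℝ} {x : Fin n → Fin p → ℝ}

instance (x : Fin n → Fin p → ℝ) : IsProbabilityMeasure (noiseLaw κ x) := by
  unfold noiseLaw; infer_instance

lemma integrable_inv_gram_mul_noiseGram
    (hx : ∀ i, IsCenteredWithVariance (κ (x i)) (σ ^ 2)) (j k : Fin p) :
    Integrable (fun ξ => ((gram x)⁻¹ * noiseGram x ξ) j k) (noiseLaw κ x) := by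
  simp_rw [inv_gram_mul_noiseGram, Matrix.sum_apply, Matrix.smul_apply, smul_eq_mul, sq]
  exact integrable_finsetSum _ fun i _ => (integrable_eval_mul_eval hx i i).mul_const _

lemma integral_inv_gram_mul_noiseGram (hG : IsUnit (gram x).det)
    (hx : ∀ i, IsCenteredWithVariance (κ (x i)) (σ ^ 2)) (j k : Fin p) :
    ∫ ξ, ((gram x)⁻¹ * noiseGram x ξ) j k ∂(noiseLaw κ x)
      = (σ ^ 2 • (1 : Matrix (Fin p) (Fin p) ℝ)) j k := by
  have h1 := congrFun (congrFun (inv_gram_mul_noiseGram x fun _ => 1) j) k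
  rw [show noiseGram x (fun _ => 1) = gram x by simp [noiseGram, gram],
    nonsing_inv_mul _ hG, Matrix.sum_apply] at h1
  simp_rw [inv_gram_mul_noiseGram, Matrix.sum_apply]
  rw [Matrix.smul_apply, h1, Finset.smul_sum, integral_finsetSum]
  · refine Finset.sum_congr rfl fun i _ => ?_
    simp_rw [Matrix.smul_apply, smul_eq_mul]
    rw [integral_mul_const]
    simp_rw [sq (_ : ℝ)]
    rw [noiseLaw, integral_eval_mul_eval hx]
    simp [sq]
  · intro i _
    simp_rw [Matrix.smul_apply, smul_eq_mul, sq]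
    exact (integrable_eval_mul_eval hx i i).mul_const _

lemma integrable_hatForm (hx : ∀ i, IsCenteredWithVariance (κ (x i)) (σ ^ 2)) :
    Integrable (hatForm x) (noiseLaw κ x) :=
  integrable_quadraticForm hx _

lemma integral_hatForm (hG : IsUnit (gram x).det)
    (hx : ∀ i, IsCenteredWithVariance (κ (x i)) (σ ^ 2)) :
    ∫ ξ, hatForm x ξ ∂(noiseLaw κ x) = σ ^ 2 * p := by
  rw [← sum_hatEntry_self hG]
  exact integral_quadraticForm hx _

lemma continuous_lsError (x : Fin n → Fin p → ℝ) : Continuous (lsError x) := by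
  unfold lsError weightedSum
  fun_prop

lemma hatForm_eq_lsError (hG : IsUnit (gram x).det) (ξ : Fin n → ℝ) :
    hatForm x ξ = ∑ i, (x i ⬝ᵥ lsError x ξ) ^ 2 :=
  hatForm_eq_sum_sq hG ξ

/-- On the lower isometry event the population norm of the least squares error is controlled by
its empirical norm, the hat form of the noise. -/
lemma integral_lsError_sq_le (hG : IsUnit (gram x).det) {η : ℝ} (hη : η < 1)
    (hL : LowerIsometry Q (linearClass p) η x) (ξ : Fin n → ℝ) :
    ∫ z, (z ⬝ᵥ lsError x ξ) ^ 2 ∂Q ≤ (1 / (1 - η)) * (hatForm x ξ / n) := by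
  have h := hL (fun z => z ⬝ᵥ lsError x ξ) ⟨_, fun _ => rfl⟩
  rw [← hatForm_eq_lsError hG] at h
  have : 0 < 1 - η := by linarith
  rw [one_div_mul_eq_div, le_div_iff₀ this, mul_comm]
  exact h.trans_eq (one_div_mul_eq_div _ _)

lemma integrable_integral_lsError_sq (hG : IsUnit (gram x).det)
    (hx : ∀ i, IsCenteredWithVariance (κ (x i)) (σ ^ 2))
    (hint : ∀ β : Fin p → ℝ, Integrable (fun x => (x ⬝ᵥ β) ^ 2) Q) {η : ℝ} (hη : η < 1)
    (hL : LowerIsometry Q (linearClass p) η x) :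
    Integrable (fun ξ => ∫ z, (z ⬝ᵥ lsError x ξ) ^ 2 ∂Q) (noiseLaw κ x) := by
  refine (((integrable_hatForm hx).div_const n).const_mul (1 / (1 - η))).mono'
    ((continuous_integral_dotProduct_sq hint).comp (continuous_lsError x)).aestronglyMeasurable
    (.of_forall fun ξ => ?_)
  rw [Real.norm_of_nonneg (integral_nonneg fun _ => sq_nonneg _)]
  exact integral_lsError_sq_le hG hη hL ξ

lemma integral_integral_lsError_sq_le (hG : IsUnit (gram x).det)
    (hx : ∀ i, IsCenteredWithVariance (κ (x i)) (σ ^ 2))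
    (hint : ∀ β : Fin p → ℝ, Integrable (fun x => (x ⬝ᵥ β) ^ 2) Q) {η : ℝ} (hη : η < 1)
    (hL : LowerIsometry Q (linearClass p) η x) :
    ∫ ξ, ∫ z, (z ⬝ᵥ lsError x ξ) ^ 2 ∂Q ∂(noiseLaw κ x) ≤ (1 / (1 - η)) * (σ ^ 2 * p / n) := by
  refine (integral_mono (integrable_integral_lsError_sq hG hx hint hη hL)
    (((integrable_hatForm hx).div_const n).const_mul (1 / (1 - η)))
    fun ξ => integral_lsError_sq_le hG hη hL ξ).trans_eq ?_
  rw [integral_const_mul, integral_div, integral_hatForm hG hx]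

/-- Markov's inequality for the population norm of the least squares error, including the
degenerate case where the bound on the mean vanishes. -/
lemma measure_integral_lsError_sq_gt_le (hG : IsUnit (gram x).det)
    (hx : ∀ i, IsCenteredWithVariance (κ (x i)) (σ ^ 2))
    (hint : ∀ β : Fin p → ℝ, Integrable (fun x => (x ⬝ᵥ β) ^ 2) Q) {η t : ℝ} (hη : η < 1)
    (ht : 0 < t) (hL : LowerIsometry Q (linearClass p) η x) :
    noiseLaw κ x {ξ | (1 / (1 - η)) * (σ ^ 2 * p / n) / t
        < ∫ z, (z ⬝ᵥ lsError x ξ) ^ 2 ∂Q} ≤ ENNReal.ofReal t := by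
  set c := (1 / (1 - η)) * (σ ^ 2 * p / n) with hc
  have hη' : 0 < 1 - η := by linarith
  have hc0 : 0 ≤ c := by positivity
  have hI := integrable_integral_lsError_sq hG hx hint hη hL
  have hle : ∫ ξ, ∫ z, (z ⬝ᵥ lsError x ξ) ^ 2 ∂Q ∂(noiseLaw κ x) ≤ c :=
    integral_integral_lsError_sq_le hG hx hint hη hL
  have hnn : 0 ≤ᵐ[noiseLaw κ x] fun ξ => ∫ z, (z ⬝ᵥ lsError x ξ) ^ 2 ∂Q :=
    .of_forall fun ξ => integral_nonneg fun _ => sq_nonneg _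
  rcases hc0.eq_or_lt with h0 | hpos
  · have hzero := (integral_eq_zero_iff_of_nonneg_ae hnn hI).1
      (le_antisymm (h0 ▸ hle) (integral_nonneg_of_ae hnn))
    rw [measure_mono_null _ (ae_iff.1 hzero)]
    · simp
    · intro ξ hξ
      rw [Set.mem_ofPred_eq, ← h0, zero_div] at hξ
      exact hξ.ne'
  · have hm := mul_meas_ge_le_integral_of_nonneg hnn hI (c / t)
    have hct : 0 < c / t := by positivity
    have hreal : (noiseLaw κ x).real {ξ | c / t ≤ ∫ z, (z ⬝ᵥ lsError x ξ) ^ 2 ∂Q} ≤ t := by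
      have h2 := hm.trans hle
      rw [← le_div_iff₀' hct] at h2
      refine h2.trans_eq ?_
      field_simp
    refine (measure_mono fun ξ hξ => ?_).trans
      ((ENNReal.le_ofReal_iff_toReal_le (measure_ne_top _ _) ht.le).2 hreal)
    exact le_of_lt (Set.mem_ofPred_eq ▸ hξ)

end Conditional

/-! ### Disintegration of the sample along the design -/

section Disintegration

variable (Q : Measure (Fin p → ℝ)) [IsProbabilityMeasure Q] (κ : Kernel (Fin p → ℝ) ℝ)
  [IsMarkovKernel κ]

lemma measurable_noiseLaw : Measurable fun x : Fin n → Fin p → ℝ => noiseLaw κ x := by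
  refine .measure_of_isPiSystem_of_isProbabilityMeasure generateFrom_pi.symm isPiSystem_pi ?_
  rintro _ ⟨s, hs, rfl⟩
  simp_rw [noiseLaw, Measure.pi_pi]
  exact Finset.measurable_prod _ fun i _ =>
    (κ.measurable_coe (hs i (Set.mem_univ i))).comp (measurable_pi_apply i)

/-- The conditional law of the noise vector given the design, as a kernel. -/
noncomputable def noiseKernel : Kernel (Fin n → Fin p → ℝ) (Fin n → ℝ) where
  toFun := noiseLaw κ
  measurable' := measurable_noiseLaw κ

instance : IsMarkovKernel (noiseKernel κ : Kernel (Fin n → Fin p → ℝ) (Fin n → ℝ)) :=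
  ⟨fun x => inferInstanceAs (IsProbabilityMeasure (noiseLaw κ x))⟩

/-- Drawing an i.i.d. sample of covariates and noises amounts to drawing the design first and
then the noise vector from its conditional law. -/
lemma pi_compProd_eq_map :
    (Measure.pi fun _ : Fin n => Q ⊗ₘ κ)
      = ((Measure.pi fun _ : Fin n => Q) ⊗ₘ noiseKernel κ).map fun z i => (z.1 i, z.2 i) := by
  refine Measure.pi_eq fun s hs => ?_
  have hm : Measurable fun (z : (Fin n → Fin p → ℝ) × (Fin n → ℝ)) i => (z.1 i, z.2 i) := by
    fun_prop
  have hS : MeasurableSet (Set.univ.pi s) := .univ_pi hs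
  have hsec : ∀ i, Measurable fun a => κ a (Prod.mk a ⁻¹' s i) := fun i =>
    Kernel.measurable_kernel_prodMk_left (hs i)
  have hpre : ∀ x : Fin n → Fin p → ℝ, noiseKernel κ x
      (Prod.mk x ⁻¹' ((fun (z : (Fin n → Fin p → ℝ) × (Fin n → ℝ)) i => (z.1 i, z.2 i)) ⁻¹'
        Set.univ.pi s)) = ∏ i, κ (x i) (Prod.mk (x i) ⁻¹' s i) := by
    intro x
    have : Prod.mk x ⁻¹' ((fun (z : (Fin n → Fin p → ℝ) × (Fin n → ℝ)) i => (z.1 i, z.2 i)) ⁻¹'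
        Set.univ.pi s) = Set.univ.pi fun i => Prod.mk (x i) ⁻¹' s i := by
      ext ξ; simp
    rw [this]
    exact Measure.pi_pi _ _
  rw [Measure.map_apply hm hS, Measure.compProd_apply (hm hS)]
  simp_rw [hpre, Measure.compProd_apply (hs _)]
  have hind : iIndepFun (fun i (x : Fin n → Fin p → ℝ) => κ (x i) (Prod.mk (x i) ⁻¹' s i))
      (Measure.pi fun _ : Fin n => Q) :=
    iIndepFun_pi (X := fun i a => κ a (Prod.mk a ⁻¹' s i)) fun i => (hsec i).aemeasurable
  rw [lintegral_prod_eq_prod_lintegral_of_indepFun _ _ hind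
    fun i => (hsec i).comp (measurable_pi_apply i)]
  refine Finset.prod_congr rfl fun i _ => ?_
  exact (measurePreserving_eval (fun _ : Fin n => Q) i).lintegral_comp (hsec i)

lemma pi_dataLaw_eq_map (βs : Fin p → ℝ) :
    (Measure.pi fun _ : Fin n => dataLaw Q κ βs)
      = ((Measure.pi fun _ : Fin n => Q) ⊗ₘ noiseKernel κ).map
          fun z i => (z.1 i, responses z.1 βs z.2 i) := by
  have hf : Measurable fun z : (Fin p → ℝ) × ℝ => (z.1, z.1 ⬝ᵥ βs + z.2) := by
    unfold dotProduct; fun_prop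
  have : ∀ _ : Fin n, SigmaFinite
      ((Q ⊗ₘ κ).map fun z : (Fin p → ℝ) × ℝ => (z.1, z.1 ⬝ᵥ βs + z.2)) := fun _ =>
    have := Measure.isProbabilityMeasure_map (μ := Q ⊗ₘ κ) hf.aemeasurable
    inferInstance
  unfold dataLaw
  rw [← Measure.pi_map_pi (fun _ => hf.aemeasurable), pi_compProd_eq_map,
    Measure.map_map (by fun_prop) (by fun_prop)]
  rfl

end Disintegration

/-! ### The deviation bound over the whole sample -/

section Sample

lemma continuous_gram : Continuous fun x : Fin n → Fin p → ℝ => gram x := by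
  unfold gram
  exact continuous_finsetSum _ fun i _ =>
    (continuous_apply i).matrix_vecMulVec (continuous_apply i)

lemma measurable_inv_gram_apply (j k : Fin p) :
    Measurable fun x : Fin n → Fin p → ℝ => (gram x)⁻¹ j k := by
  simp_rw [Matrix.inv_def, Matrix.smul_apply, Ring.inverse_eq_inv', smul_eq_mul]
  exact (continuous_gram.matrix_det.measurable.inv).mul
    (continuous_gram.matrix_adjugate.matrix_elem j k).measurable

lemma measurable_lsError :
    Measurable fun z : (Fin n → Fin p → ℝ) × (Fin n → ℝ) => lsError z.1 z.2 := by
  refine measurable_pi_lambda _ fun j => ?_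
  simp_rw [lsError, mulVec, dotProduct, weightedSum, Finset.sum_apply, Pi.smul_apply, smul_eq_mul]
  exact Finset.measurable_sum _ fun k _ =>
    ((measurable_inv_gram_apply j k).comp measurable_fst).mul (by fun_prop)

variable {Q : Measure (Fin p → ℝ)}

lemma measurableSet_lowerIsometry (η : ℝ) :
    MeasurableSet {x : Fin n → Fin p → ℝ | LowerIsometry Q (linearClass p) η x} := by
  have : {x : Fin n → Fin p → ℝ | LowerIsometry Q (linearClass p) η x}
      = ⋂ β : Fin p → ℝ, {x | (1 - η) * ∫ z, (z ⬝ᵥ β) ^ 2 ∂Q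
          ≤ (1 / (n : ℝ)) * ∑ i, (x i ⬝ᵥ β) ^ 2} := by
    ext x
    simp only [Set.mem_ofPred_eq, Set.mem_iInter]
    refine ⟨fun h β => h _ ⟨β, fun _ => rfl⟩, ?_⟩
    rintro h f ⟨β, hβ⟩
    obtain rfl : f = fun z => z ⬝ᵥ β := funext hβ
    exact h β
  rw [this]
  refine (isClosed_iInter fun β => ?_).measurableSet
  unfold dotProduct
  exact isClosed_le continuous_const (by fun_prop)

/-- Under the lower isometry bound, non-degeneracy passes from the population to the design. -/
lemma LowerIsometry.isUnit_det_gram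
    (hpos : ∀ β : Fin p → ℝ, β ≠ 0 → 0 < ∫ x, (x ⬝ᵥ β) ^ 2 ∂Q) {η : ℝ} (hη : η < 1)
    {x : Fin n → Fin p → ℝ} (hL : LowerIsometry Q (linearClass p) η x) :
    IsUnit (gram x).det := by
  rw [isUnit_iff_ne_zero]
  intro h0
  obtain ⟨β, hβ, hGβ⟩ := Matrix.exists_mulVec_eq_zero_iff.2 h0
  have h := hL (fun z => z ⬝ᵥ β) ⟨β, fun _ => rfl⟩
  rw [← dotProduct_gram_mulVec, hGβ, dotProduct_zero, mul_zero] at h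
  have := mul_pos (sub_pos.2 hη) (hpos β hβ)
  linarith

variable [IsProbabilityMeasure Q] {κ : Kernel (Fin p → ℝ) ℝ} [IsMarkovKernel κ] {σ : ℝ}

lemma measure_lsError_sq_gt_le (hQ : WellSpecified Q κ σ)
    (hint : ∀ β : Fin p → ℝ, Integrable (fun x => (x ⬝ᵥ β) ^ 2) Q)
    (hpos : ∀ β : Fin p → ℝ, β ≠ 0 → 0 < ∫ x, (x ⬝ᵥ β) ^ 2 ∂Q) {η δ t : ℝ} (hη : η < 1)
    (ht : 0 < t)
    (hL : 1 - δ ≤ (Measure.pi fun _ : Fin n => Q).real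
      {x | LowerIsometry Q (linearClass p) η x}) :
    ((Measure.pi fun _ : Fin n => Q) ⊗ₘ noiseKernel κ)
        {z | ¬ LowerIsometry Q (linearClass p) η z.1 ∨
          (1 / (1 - η)) * (σ ^ 2 * p / n) / t < ∫ w, (w ⬝ᵥ lsError z.1 z.2) ^ 2 ∂Q}
      ≤ ENNReal.ofReal (δ + t) := by
  set E := {x : Fin n → Fin p → ℝ | LowerIsometry Q (linearClass p) η x} with hE
  have hEm : MeasurableSet E := measurableSet_lowerIsometry η
  have hδ : 0 ≤ δ := by
    have : (Measure.pi fun _ : Fin n => Q).real E ≤ 1 := measureReal_le_one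
    linarith
  have hEc : (Measure.pi fun _ : Fin n => Q) Eᶜ ≤ ENNReal.ofReal δ := by
    rw [ENNReal.le_ofReal_iff_toReal_le (measure_ne_top _ _) hδ]
    change (Measure.pi fun _ : Fin n => Q).real Eᶜ ≤ δ
    rw [probReal_compl_eq_one_sub hEm]
    linarith
  have hm : MeasurableSet {z : (Fin n → Fin p → ℝ) × (Fin n → ℝ) |
      ¬ LowerIsometry Q (linearClass p) η z.1 ∨
        (1 / (1 - η)) * (σ ^ 2 * p / n) / t < ∫ w, (w ⬝ᵥ lsError z.1 z.2) ^ 2 ∂Q} :=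
    (measurable_fst hEm.compl).union (measurableSet_lt measurable_const
      ((continuous_integral_dotProduct_sq hint).measurable.comp measurable_lsError))
  rw [Measure.compProd_apply hm, ENNReal.ofReal_add hδ ht.le]
  calc _ ≤ ∫⁻ x, (Eᶜ.indicator 1 x + ENNReal.ofReal t) ∂(Measure.pi fun _ : Fin n => Q) := by
        refine lintegral_mono_ae ?_
        filter_upwards [hQ.ae_pi_isCentered (n := n)] with x hx
        by_cases hxE : x ∈ E
        · have hxL : LowerIsometry Q (linearClass p) η x := hxE
          refine le_trans ?_ le_add_self
          have := measure_integral_lsError_sq_gt_le (hxL.isUnit_det_gram hpos hη) hx hint hη ht hxL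
          refine (measure_mono fun ξ hξ => ?_).trans this
          exact hξ.resolve_left (not_not_intro hxL)
        · rw [Set.indicator_of_mem (show x ∈ Eᶜ from hxE)]
          exact prob_le_one.trans le_self_add
    _ = (Measure.pi fun _ : Fin n => Q) Eᶜ + ENNReal.ofReal t := by
        rw [lintegral_add_right _ measurable_const, lintegral_indicator_one hEm.compl]
        simp
    _ ≤ _ := by gcongr

theorem measure_excessLoss_gt_le (hQ : WellSpecified Q κ σ)
    (hint : ∀ β : Fin p → ℝ, Integrable (fun x => (x ⬝ᵥ β) ^ 2) Q) (βs : Fin p → ℝ)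
    {fhat : (Fin n → Fin p → ℝ) → (Fin n → ℝ) → (Fin p → ℝ) → ℝ}
    (hfhat : ∀ x y, IsStarEstimator (linearClass p) x y (fhat x y))
    (hpos : ∀ β : Fin p → ℝ, β ≠ 0 → 0 < ∫ x, (x ⬝ᵥ β) ^ 2 ∂Q) {η δ t : ℝ} (hη : η < 1)
    (ht : 0 < t)
    (hL : 1 - δ ≤ (Measure.pi fun _ : Fin n => Q).real
      {x | LowerIsometry Q (linearClass p) η x}) :
    (Measure.pi fun _ : Fin n => dataLaw Q κ βs).real
        {z | (1 / (1 - η)) * (σ ^ 2 * p / n) / t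
          < excessLoss (dataLaw Q κ βs) (linearClass p)
              (fhat (fun i => (z i).1) (fun i => (z i).2))} ≤ δ + t := by
  have hδ : 0 ≤ δ := by
    have : (Measure.pi fun _ : Fin n => Q).real
      {x | LowerIsometry Q (linearClass p) η x} ≤ 1 := measureReal_le_one
    linarith
  -- `fhat` need not be measurable, so the event is first enlarged to one about the sample in
  -- which the estimator has been replaced by the explicit least squares solution
  set T : Set (Fin n → (Fin p → ℝ) × ℝ) :=
    {z | ¬ LowerIsometry Q (linearClass p) η (fun i => (z i).1) ∨
      (1 / (1 - η)) * (σ ^ 2 * p / n) / t <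
        ∫ w, (w ⬝ᵥ lsError (fun i => (z i).1) (fun i => (z i).2 - (z i).1 ⬝ᵥ βs)) ^ 2 ∂Q}
    with hT
  have hTm : MeasurableSet T := by
    have h1 : Measurable fun (z : Fin n → (Fin p → ℝ) × ℝ) i => (z i).1 := by fun_prop
    have h2 : Measurable fun (z : Fin n → (Fin p → ℝ) × ℝ) i => (z i).2 - (z i).1 ⬝ᵥ βs := by
      unfold dotProduct; fun_prop
    exact (h1 (measurableSet_lowerIsometry η).compl).union (measurableSet_lt measurable_const
      ((continuous_integral_dotProduct_sq hint).measurable.comp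
        (measurable_lsError.comp (h1.prodMk h2))))
  refine ENNReal.toReal_le_of_le_ofReal (by positivity)
    ((measure_mono (t := T) fun z hz => ?_).trans ?_)
  · by_cases hLz : LowerIsometry Q (linearClass p) η (fun i => (z i).1)
    · right
      have hG := hLz.isUnit_det_gram hpos hη
      have hy : (fun i => (z i).2) = responses (fun i => (z i).1) βs
          (fun i => (z i).2 - (z i).1 ⬝ᵥ βs) := by
        ext i; simp [responses]
      rw [Set.mem_ofPred_eq, hy, (hfhat _ _).isEmpMin.eq_dotProduct hG,
        excessLoss_dotProduct hQ hint] at hz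
      exact hz
    · exact Or.inl hLz
  · have hφ : Measurable fun (z : (Fin n → Fin p → ℝ) × (Fin n → ℝ)) i =>
        (z.1 i, responses z.1 βs z.2 i) := by
      unfold responses dotProduct; fun_prop
    rw [pi_dataLaw_eq_map, Measure.map_apply hφ hTm]
    refine le_trans (le_of_eq ?_) (measure_lsError_sq_gt_le hQ hint hpos hη ht hL)
    congr 1
    ext z
    simp [hT, responses]

end Sample

end OffsetRegression

theorem mainTheorem10 {Ω : Type*} [MeasurableSpace Ω] (P : Measure Ω) [IsProbabilityMeasure P]
    (n p : ℕ) (ε : Fin n → Ω → ℝ) (hε : IsRademacher ε P)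
    (C : ℝ) (hC : 0 < C) :
    -- fixed design and fixed (arbitrary) noise: expectation and deviation over the signs
    (∀ (X : Fin n → Fin p → ℝ) (ξ : Fin n → ℝ),
      IsUnit (gram X).det →
      (∀ e : Fin n → ℝ, BddAbove (Set.range (offsetProcess C X ξ e))) ∧
      Integrable (fun ω => offsetSup C X ξ (fun i => ε i ω)) P ∧
      ∫ ω, offsetSup C X ξ (fun i => ε i ω) ∂P
        = ((gram X)⁻¹ * noiseGram X ξ).trace / (C * n) ∧
      ∀ δ : ℝ, 0 < δ → δ ≤ 1 →
        (noiseGram X ξ ≠ 0 →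
          P.real {ω | ((gram X)⁻¹ * noiseGram X ξ).trace / (C * n)
              + √((((gram X)⁻¹ * noiseGram X ξ) ^ 2).trace)
                  / (C * n) * (4 * √(2 * Real.log (1 / δ)) + 64 * Real.log (1 / δ))
              ≤ offsetSup C X ξ (fun i => ε i ω)} ≤ δ) ∧
        P.real {ω | ((gram X)⁻¹ * noiseGram X ξ).trace / (C * n)
              + √((((gram X)⁻¹ * noiseGram X ξ) ^ 2).trace)
                  / (C * n) * (4 * √(2 * Real.log (1 / δ)) + 64 * Real.log (1 / δ))
              < offsetSup C X ξ (fun i => ε i ω)} ≤ δ) ∧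
    -- the well-specified case, i.i.d. sample
    (∀ (Q : Measure (Fin p → ℝ)) [IsProbabilityMeasure Q]
      (κ : Kernel (Fin p → ℝ) ℝ) [IsMarkovKernel κ] (βs : Fin p → ℝ) (σ : ℝ),
      WellSpecified Q κ σ →
      (∀ β : Fin p → ℝ, Integrable (fun x => (x ⬝ᵥ β) ^ 2) Q) →
      ∀ fhat : (Fin n → Fin p → ℝ) → (Fin n → ℝ) → (Fin p → ℝ) → ℝ,
      (∀ x y, IsStarEstimator (linearClass p) x y (fhat x y)) →
      -- conditionally on the design
      (∀ᵐ x ∂(Measure.pi fun _ : Fin n => Q), IsUnit (gram x).det →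
        (∀ j k : Fin p,
          Integrable (fun ξ => ((gram x)⁻¹ * noiseGram x ξ) j k)
            (noiseLaw κ x) ∧
          ∫ ξ, ((gram x)⁻¹ * noiseGram x ξ) j k
            ∂(noiseLaw κ x) = (σ ^ 2 • (1 : Matrix (Fin p) (Fin p) ℝ)) j k) ∧
        (Integrable (fun ξ => ∫ ω, offsetSup C x ξ (fun i => ε i ω) ∂P)
            (noiseLaw κ x) ∧
          ∫ ξ, ∫ ω, offsetSup C x ξ (fun i => ε i ω) ∂P
            ∂(noiseLaw κ x) = σ ^ 2 * p / (C * n)) ∧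
        (Integrable (fun ξ => fixedDesignExcess κ βs x
            (fhat x (responses x βs ξ))) (noiseLaw κ x) ∧
          ∫ ξ, fixedDesignExcess κ βs x
            (fhat x (responses x βs ξ)) ∂(noiseLaw κ x)
            ≤ σ ^ 2 * p / n) ∧
        ∀ η : ℝ, η < 1 →
          LowerIsometry Q (linearClass p) η x →
          Integrable (fun ξ => excessLoss (dataLaw Q κ βs)
              (linearClass p) (fhat x (responses x βs ξ)))
            (noiseLaw κ x) ∧
          ∫ ξ, excessLoss (dataLaw Q κ βs)
              (linearClass p) (fhat x (responses x βs ξ))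
            ∂(noiseLaw κ x) ≤ (1 / (1 - η)) * (σ ^ 2 * p / n)) ∧
      -- with high probability over the whole sample, under the lower isometry bound
      ((∀ β : Fin p → ℝ, β ≠ 0 → 0 < ∫ x, (x ⬝ᵥ β) ^ 2 ∂Q) →
        ∀ η δ t : ℝ, η < 1 → 0 < t →
          1 - δ ≤ (Measure.pi fun _ : Fin n => Q).real
            {x | LowerIsometry Q (linearClass p) η x} →
          (Measure.pi fun _ : Fin n => dataLaw Q κ βs).real
            {z | (1 / (1 - η)) * (σ ^ 2 * p / n) / t
              < excessLoss (dataLaw Q κ βs)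
                (linearClass p)
                (fhat (fun i => (z i).1) (fun i => (z i).2))} ≤ δ + t)) := by
  refine ⟨fun X ξ hG => ⟨fun e => (isGreatest_offsetProcess hC hG ξ e).bddAbove,
    hε.integrable_offsetSup hC hG ξ, hε.integral_offsetSup hC hG ξ, fun δ hδ0 hδ1 =>
    ⟨fun hH => hε.measure_offsetSup_ge_le hC hG hH hδ0 hδ1,
      hε.measure_offsetSup_gt_le hC hG ξ hδ0 hδ1⟩⟩, ?_⟩
  intro Q _ κ _ βs σ hQ hint fhat hfhat
  refine ⟨?_, fun hpos η δ t hη ht hL => measure_excessLoss_gt_le hQ hint βs hfhat hpos hη ht hL⟩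
  filter_upwards [hQ.ae_pi_isCentered (n := n)] with x hx hG
  have hls : ∀ ξ, fhat x (responses x βs ξ) = fun z => z ⬝ᵥ (βs + lsError x ξ) := fun ξ =>
    (hfhat _ _).isEmpMin.eq_dotProduct hG
  have hjj := fun j : Fin p => integrable_inv_gram_mul_noiseGram hx j j
  refine ⟨fun j k => ⟨integrable_inv_gram_mul_noiseGram hx j k,
    integral_inv_gram_mul_noiseGram hG hx j k⟩, ?_, ?_, ?_⟩
  · simp_rw [hε.integral_offsetSup hC hG, trace, diag_apply]
    refine ⟨(integrable_finsetSum _ fun j _ => hjj j).div_const _, ?_⟩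
    rw [integral_div, integral_finsetSum _ fun j _ => hjj j]
    simp_rw [integral_inv_gram_mul_noiseGram hG hx]
    simp [mul_comm]
  · simp_rw [hls, fixedDesignExcess_dotProduct hx, ← hatForm_eq_lsError hG]
    refine ⟨(integrable_hatForm hx).const_mul _, le_of_eq ?_⟩
    rw [integral_const_mul, integral_hatForm hG hx, one_div_mul_eq_div]
  · intro η hη hL
    simp_rw [hls, excessLoss_dotProduct hQ hint]
    exact ⟨integrable_integral_lsError_sq hG hx hint hη hL,
      integral_integral_lsError_sq_le hG hx hint hη hL⟩
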